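/- Let $\theta$ be irrational and let $\mathcal A_\theta$ be the irrational rotation algebra, i.e. the $C^*$-algebra generated by two unitaries $U,V$ with $VU=e^{2\pi i\theta}UV$ (realised on $\ell^2(\mathbb Z^2)$ by $Ue_{n,m}=e_{n+1,m}$, $Ve_{n,m}=e^{2\pi i\theta n}e_{n,m+1}$). Let $\tau(b)=\langle e_{0,0},b\,e_{0,0}\rangle$ be its canonical trace, so that $\tau(1)=1$ and $\tau(U^nV^m)=0$ for $(n,m)\neq(0,0)$. Let $\mathcal M_\tau$ be the set of states of $\mathcal A_\theta$ of the form $\varphi(b)=\tau(b\xi)$ with $\xi\in\mathcal A_\theta$ positive; the density $\xi$ is uniquely determined by $\varphi$. For $\varphi=\tau(\cdot\,\xi)$ and $\psi=\tau(\cdot\,\eta)$ in $\mathcal M_\tau$ with $\eta$ invertible, let $$S(\varphi\|\psi)=\tau\big(\xi(\log\xi-\log\eta)\big)$$ be the relative entropy, where $\xi\log\xi$ is defined by continuous functional calculus with $0\log 0=0$. For $\beta>0$ and $a\in\mathcal A_\theta$ positive, let the thermodynamically deformed trace be $$\tau_{\beta,S}(a)=\min_{\varphi\in\mathcal M_\tau}\{\varphi(a)+\beta^{-1}S(\varphi\|\tau)\}.$$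 **Proposition.** Let $\beta>0$ and $a=h^*h$ with $h\in\mathcal A_\theta$. Then $\tau(e^{-\beta a})$ is a positive real number, the functional $$\varphi_{\beta,a}(b)=\frac{\tau(b\,e^{-\beta a})}{\tau(e^{-\beta a})}$$ belongs to $\mathcal M_\tau$, and it is a KMS$_\beta$ state of the time evolution $\sigma_t(b)=e^{ita}\,b\,e^{-ita}$ on $\mathcal A_\theta$. For every $\varphi\in\mathcal M_\tau$, $$\varphi(a)+\beta^{-1}S(\varphi\|\tau)=\beta^{-1}S(\varphi\|\varphi_{\beta,a})-\beta^{-1}\log\tau(e^{-\beta a}).$$ The minimum defining $\tau_{\beta,S}(a)$ exists, is attained at $\varphi_{\beta,a}$, and equals the Helmholtz free energy: $$\tau_{\beta,S}(a)=\min_{\varphi\in\mathcal M_\tau}\{\beta^{-1}S(\varphi\|\varphi_{\beta,a})-\beta^{-1}\log\tau(e^{-\beta a})\}=-\beta^{-1}\log\tau(e^{-\beta a}).$$ Here a KMS$_\beta$ state for $\sigma$ is a state $\varphi$ such that for all $x,y$ there is a bounded continuous function $F$ on the strip $0\le\operatorname{Im}z\le\beta$, holomorphic in its interior, with $F(t)=\varphi(x\sigma_t(y))$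 and $F(t+i\beta)=\varphi(\sigma_t(y)x)$ for all $t\in\mathbb R$. -/

import Mathlib

noncomputable section

namespace NCTorus

/-! ### States, densities and relative entropy on a unital C*-algebra with a trace -/

section CStar

variable {A : Type*} [CStarAlgebra A]

/-- Positive elements of a C*-algebra: those of the form `k* k`. -/
def IsPos (x : A) : Prop := ∃ k : A, x = star k * k

/-- States: continuous linear functionals with `φ 1 = 1` and `φ (x* x) ≥ 0`
(real and non-negative). -/
def IsState (φ : A →L[ℂ] ℂ) : Prop :=
  φ 1 = 1 ∧ ∀ x : A, 0 ≤ (φ (star x * x)).re ∧ (φ (star x * x)).im = 0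

/-- The functional `b ↦ τ (b ξ)`. -/
def densityFunctional (τ : A →L[ℂ] ℂ) (ξ : A) : A →L[ℂ] ℂ :=
  τ.comp ((ContinuousLinearMap.mul ℂ A).flip ξ)

theorem densityFunctional_apply (τ : A →L[ℂ] ℂ) (ξ b : A) :
    densityFunctional τ ξ b = τ (b * ξ) := rfl

/-- The set of states of the form `b ↦ τ (b ξ)` for some positive element `ξ`. -/
def statesWithDensity (τ : A →L[ℂ] ℂ) : Set (A →L[ℂ] ℂ) :=
  {φ | IsState φ ∧ ∃ ξ : A, IsPos ξ ∧ φ = densityFunctional τ ξ}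

open Classical in
/-- The positive element `ξ` with `φ b = τ (b ξ)` for all `b`, if there is one (`0` otherwise).
It is unique when `τ` is a faithful positive functional, see `density_densityFunctional`. -/
def density (τ φ : A →L[ℂ] ℂ) : A :=
  if h : ∃ ξ : A, IsPos ξ ∧ φ = densityFunctional τ ξ then h.choose else 0

/-- Relative entropy `S(φ ‖ ψ) = τ (ξ (log ξ - log η))` of the states `φ = τ (· ξ)` and
`ψ = τ (· η)`, where `η` is invertible. The product `ξ log ξ` is the element `f(ξ)` of the
continuous functional calculus for `f t = t log t`, `f 0 = 0`, so that `ξ` need not be invertible.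
For a trace `τ` the number whose real part is taken is real. -/
def relEntropy (τ φ ψ : A →L[ℂ] ℂ) : ℝ :=
  (τ (cfc (fun t : ℝ => t * Real.log t) (density τ φ) - density τ φ * CFC.log (density τ ψ))).re

/-- The set of all values `φ a + β⁻¹ S(φ ‖ τ)` over the states `φ = τ (· ξ)`. -/
def freeEnergyValues (τ : A →L[ℂ] ℂ) (β : ℝ) (a : A) : Set ℝ :=
  {x | ∃ φ ∈ statesWithDensity τ, x = (φ a).re + β⁻¹ * relEntropy τ φ τ}

/-- The thermodynamic deformation of `τ` at `a`: the minimum of `φ a + β⁻¹ S(φ ‖ τ)` over the states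
`φ = τ (· ξ)`. It is written as an infimum; a claim about the deformed trace should say that
the infimum is attained. -/
def deformedTrace (τ : A →L[ℂ] ℂ) (β : ℝ) (a : A) : ℝ := sInf (freeEnergyValues τ β a)

/-- `exp (- β a)`. -/
def boltzmann (β : ℝ) (a : A) : A := NormedSpace.exp ((-β) • a)

/-- The functional `b ↦ τ (b exp (- β a)) / τ (exp (- β a))`. -/
def gibbs (τ : A →L[ℂ] ℂ) (β : ℝ) (a : A) : A →L[ℂ] ℂ :=
  (τ (boltzmann β a))⁻¹ • densityFunctional τ (boltzmann β a)

/-- The evolution `σ_t b = exp (i t a) b exp (- i t a)` for self-adjoint `a`;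
here `selfAdjoint.expUnitary x` is the unitary `exp (i x)`. -/
def evolution (a : selfAdjoint A) (t : ℝ) : A ≃⋆ₐ[ℂ] A :=
  Unitary.conjStarAlgAut ℂ A (selfAdjoint.expUnitary (t • a))

/-- A time evolution: a pointwise norm continuous one-parameter group of `*`-automorphisms. -/
structure IsTimeEvolution (σ : ℝ → A ≃⋆ₐ[ℂ] A) : Prop where
  map_zero : ∀ b, σ 0 b = b
  map_add : ∀ s t b, σ (s + t) b = σ s (σ t b)
  continuous : ∀ b, Continuous fun t => σ t b

/-- `φ` is a `KMS_β` state for `σ`: for all `x y` there is a bounded continuous function `F` on the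
strip `0 ≤ Im z ≤ β`, holomorphic inside, with `F t = φ (x σ_t(y))` and
`F (t + i β) = φ (σ_t(y) x)`. -/
def IsKMSState (σ : ℝ → A ≃⋆ₐ[ℂ] A) (β : ℝ) (φ : A →L[ℂ] ℂ) : Prop :=
  IsState φ ∧ ∀ x y : A, ∃ F : ℂ → ℂ,
    ContinuousOn F {z | 0 ≤ z.im ∧ z.im ≤ β} ∧
    DifferentiableOn ℂ F {z | 0 < z.im ∧ z.im < β} ∧
    (∃ C : ℝ, ∀ z : ℂ, 0 ≤ z.im → z.im ≤ β → ‖F z‖ ≤ C) ∧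
    ∀ t : ℝ, F t = φ (x * σ t y) ∧ F (t + β * Complex.I) = φ (σ t y * x)

/-- Densities with respect to a faithful functional are unique. -/
theorem density_densityFunctional {τ : A →L[ℂ] ℂ} (hτ : ∀ x : A, τ (star x * x) = 0 → x = 0)
    {ξ : A} (hξ : IsPos ξ) : density τ (densityFunctional τ ξ) = ξ := by
  have h : ∃ ζ : A, IsPos ζ ∧ densityFunctional τ ξ = densityFunctional τ ζ := ⟨ξ, hξ, rfl⟩
  rw [density, dif_pos h]
  have h2 := h.choose_spec.2
  set ζ := h.choose
  have key := DFunLike.congr_fun h2 (star (ξ - ζ))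
  have key' : τ (star (ξ - ζ) * ξ) = τ (star (ξ - ζ) * ζ) := by
    simpa only [densityFunctional, ContinuousLinearMap.comp_apply, ContinuousLinearMap.flip_apply,
      ContinuousLinearMap.mul_apply'] using key
  have := hτ (ξ - ζ) (by rw [mul_sub, map_sub, key', sub_self])
  exact (sub_eq_zero.mp this).symm

end CStar

/-! ### The irrational rotation algebra and its canonical trace -/

/-- The Hilbert space `ℓ²(ℤ²)`. -/
abbrev L2Z2 : Type := lp (fun _ : ℤ × ℤ => ℂ) 2

theorem memℓp_weightedShift (e : ℤ × ℤ ≃ ℤ × ℤ) (c : ℤ × ℤ → Circle) (f : L2Z2) :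
    Memℓp (fun p => (c p : ℂ) * f (e p)) 2 := by
  have hf := (memℓp_gen_iff (p := 2) (by norm_num)).1 (lp.memℓp f)
  refine (memℓp_gen_iff (p := 2) (by norm_num)).2 ?_
  simpa [Function.comp_def, norm_mul, Circle.norm_coe] using (e.summable_iff (f := fun p => ‖f p‖ ^ (2 : ENNReal).toReal)).2 hf

/-- The unitary operator `(T f)(p) = c(p) f(e(p))` on `ℓ²(ℤ²)`. -/
def weightedShift (e : ℤ × ℤ ≃ ℤ × ℤ) (c : ℤ × ℤ → Circle) : L2Z2 ≃ₗᵢ[ℂ] L2Z2 where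
  toFun f := ⟨fun p => (c p : ℂ) * f (e p), memℓp_weightedShift e c f⟩
  invFun f := ⟨fun p => (((c (e.symm p))⁻¹ : Circle) : ℂ) * f (e.symm p),
    memℓp_weightedShift e.symm (fun p => (c (e.symm p))⁻¹) f⟩
  map_add' f g := by
    ext p
    exact mul_add _ _ _
  map_smul' z f := by
    ext p
    simp [mul_left_comm]
  left_inv f := by
    ext p
    simp
  right_inv f := by
    ext p
    simp
  norm_map' f := by
    have h2 : 0 < (2 : ENNReal).toReal := by norm_num
    rw [lp.norm_eq_tsum_rpow h2, lp.norm_eq_tsum_rpow h2]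
    congr 1
    simpa [norm_mul, Circle.norm_coe] using e.tsum_eq fun p => ‖f p‖ ^ (2 : ENNReal).toReal

theorem weightedShift_apply (e : ℤ × ℤ ≃ ℤ × ℤ) (c : ℤ × ℤ → Circle) (f : L2Z2) (p : ℤ × ℤ) :
    weightedShift e c f p = (c p : ℂ) * f (e p) := rfl

/-- `(U f)(n, m) = f(n - 1, m)`, that is `U e_{n,m} = e_{n+1,m}`. -/
def opU : L2Z2 →L[ℂ] L2Z2 :=
  (weightedShift (Equiv.subRight ((1, 0) : ℤ × ℤ)) (fun _ => 1)).toContinuousLinearEquiv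

/-- `(V f)(n, m) = exp(2 π i θ n) f(n, m - 1)`, that is
`V e_{n,m} = exp(2 π i θ n) e_{n,m+1}`. -/
def opV (θ : ℝ) : L2Z2 →L[ℂ] L2Z2 :=
  (weightedShift (Equiv.subRight ((0, 1) : ℤ × ℤ))
    (fun p => Circle.exp (2 * Real.pi * θ * p.1))).toContinuousLinearEquiv

/-- The rotation algebra `A_θ`: the C*-algebra of operators on `ℓ²(ℤ²)` generated by the
unitaries `U`, `V`, which satisfy `V U = exp(2 π i θ) U V`. For irrational `θ` it is, up to
isomorphism, the only C*-algebra generated by two such unitaries. -/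
def rotationAlgebra (θ : ℝ) : StarSubalgebra ℂ (L2Z2 →L[ℂ] L2Z2) :=
  (StarAlgebra.adjoin ℂ {opU, opV θ}).topologicalClosure

instance (θ : ℝ) : IsClosed (rotationAlgebra θ : Set (L2Z2 →L[ℂ] L2Z2)) :=
  StarSubalgebra.isClosed_topologicalClosure _

/-- The C*-algebra structure of `A_θ`, inherited from the bounded operators on `ℓ²(ℤ²)`. -/
instance (θ : ℝ) : CStarAlgebra (rotationAlgebra θ) := StarSubalgebra.cstarAlgebra _

theorem opU_apply (f : L2Z2) (q : ℤ × ℤ) : opU f q = f (q - (1, 0)) := by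
  change ((1 : Circle) : ℂ) * f (q - (1, 0)) = _
  simp

theorem opV_apply (θ : ℝ) (f : L2Z2) (q : ℤ × ℤ) :
    opV θ f q = (Circle.exp (2 * Real.pi * θ * q.1) : ℂ) * f (q - (0, 1)) := rfl

theorem opU_single (p : ℤ × ℤ) :
    opU (lp.single 2 p (1 : ℂ)) = (lp.single 2 (p + (1, 0)) (1 : ℂ) : L2Z2) := by
  ext q
  change ((1 : Circle) : ℂ) * (lp.single 2 p (1 : ℂ) : L2Z2) (q - (1, 0)) = _
  simp [lp.single_apply, Pi.single_apply, sub_eq_iff_eq_add]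

theorem opV_single (θ : ℝ) (p : ℤ × ℤ) :
    opV θ (lp.single 2 p (1 : ℂ)) =
      Complex.exp (2 * Real.pi * Complex.I * θ * p.1) •
        (lp.single 2 (p + (0, 1)) (1 : ℂ) : L2Z2) := by
  ext q
  change (Circle.exp (2 * Real.pi * θ * q.1) : ℂ) * (lp.single 2 p (1 : ℂ) : L2Z2) (q - (0, 1)) =
    Complex.exp (2 * Real.pi * Complex.I * θ * p.1) *
      (lp.single 2 (p + (0, 1)) (1 : ℂ) : L2Z2) q
  simp only [lp.single_apply, Pi.single_apply, sub_eq_iff_eq_add]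
  split_ifs with h
  · subst h
    simp only [Circle.coe_exp, Prod.fst_add, add_zero, mul_one]
    congr 1
    push_cast
    ring
  · simp

theorem opU_mem_unitary : opU ∈ unitary (L2Z2 →L[ℂ] L2Z2) :=
  (Unitary.linearIsometryEquiv.symm
    (weightedShift (Equiv.subRight ((1, 0) : ℤ × ℤ)) (fun _ => 1))).2

theorem opV_mem_unitary (θ : ℝ) : opV θ ∈ unitary (L2Z2 →L[ℂ] L2Z2) :=
  (Unitary.linearIsometryEquiv.symm (weightedShift (Equiv.subRight ((0, 1) : ℤ × ℤ))
    (fun p => Circle.exp (2 * Real.pi * θ * p.1)))).2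

/-- The generator `U` of `A_θ`. -/
def genU (θ : ℝ) : unitary (rotationAlgebra θ) :=
  ⟨⟨opU, StarSubalgebra.le_topologicalClosure _ (StarAlgebra.subset_adjoin ℂ _ (by simp))⟩, by
    have := Unitary.mem_iff.1 opU_mem_unitary
    exact Unitary.mem_iff.2 ⟨Subtype.ext this.1, Subtype.ext this.2⟩⟩

/-- The generator `V` of `A_θ`. -/
def genV (θ : ℝ) : unitary (rotationAlgebra θ) :=
  ⟨⟨opV θ, StarSubalgebra.le_topologicalClosure _ (StarAlgebra.subset_adjoin ℂ _ (by simp))⟩, by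
    have := Unitary.mem_iff.1 (opV_mem_unitary θ)
    exact Unitary.mem_iff.2 ⟨Subtype.ext this.1, Subtype.ext this.2⟩⟩

/-- The defining relation `V U = exp(2 π i θ) U V`. -/
theorem genV_mul_genU (θ : ℝ) :
    (genV θ * genU θ : rotationAlgebra θ) =
      Complex.exp (2 * Real.pi * Complex.I * θ) • (genU θ * genV θ : rotationAlgebra θ) := by
  apply Subtype.ext
  refine ContinuousLinearMap.ext fun f => ?_
  ext q
  change (Circle.exp (2 * Real.pi * θ * q.1) : ℂ) * (((1 : Circle) : ℂ) * f (q - (0, 1) - (1, 0))) =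
    Complex.exp (2 * Real.pi * Complex.I * θ) * (((1 : Circle) : ℂ) *
      ((Circle.exp (2 * Real.pi * θ * (q - (1, 0)).1) : ℂ) * f (q - (1, 0) - (0, 1))))
  rw [sub_right_comm]
  simp only [Circle.coe_exp, Circle.coe_one, one_mul, ← mul_assoc, ← Complex.exp_add]
  congr 2
  push_cast [Prod.fst_sub]
  ring

/-- The canonical trace `τ b = ⟨e_{0,0}, b e_{0,0}⟩`; its values on the monomials `U^n V^m` are
computed in `trace_monomial`. -/
def trace (θ : ℝ) : rotationAlgebra θ →L[ℂ] ℂ :=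
  (innerSL ℂ (lp.single 2 (0 : ℤ × ℤ) (1 : ℂ) : L2Z2)).comp
    ((ContinuousLinearMap.apply ℂ L2Z2 (lp.single 2 (0 : ℤ × ℤ) (1 : ℂ) : L2Z2)).comp
      (rotationAlgebra θ).toSubalgebra.toSubmodule.subtypeL)

theorem trace_eq_inner (θ : ℝ) (b : rotationAlgebra θ) :
    trace θ b = inner ℂ (lp.single 2 (0 : ℤ × ℤ) (1 : ℂ) : L2Z2)
      ((b : L2Z2 →L[ℂ] L2Z2) (lp.single 2 (0 : ℤ × ℤ) (1 : ℂ))) := rfl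

theorem zpow_apply {θ : ℝ} (u : unitary (rotationAlgebra θ)) (x : ℤ → L2Z2)
    (hx : ∀ k, ((u : rotationAlgebra θ) : L2Z2 →L[ℂ] L2Z2) (x k) = x (k + 1)) (n k : ℤ) :
    (((u ^ n : unitary (rotationAlgebra θ)) : rotationAlgebra θ) : L2Z2 →L[ℂ] L2Z2) (x k) =
      x (k + n) := by
  induction n using Int.induction_on generalizing k with
  | zero => simp
  | succ n ih =>
    rw [zpow_add_one]
    change ((((u ^ (n : ℤ) : unitary (rotationAlgebra θ)) : rotationAlgebra θ) :
      L2Z2 →L[ℂ] L2Z2)) (((u : rotationAlgebra θ) : L2Z2 →L[ℂ] L2Z2) (x k)) = _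
    rw [hx, ih]
    congr 1
    ring
  | pred n ih =>
    have h1 : x k = ((u : rotationAlgebra θ) : L2Z2 →L[ℂ] L2Z2) (x (k - 1)) := by
      rw [hx, sub_add_cancel]
    rw [h1]
    change ((((u ^ (-(n : ℤ) - 1) * u : unitary (rotationAlgebra θ)) : rotationAlgebra θ) :
      L2Z2 →L[ℂ] L2Z2)) (x (k - 1)) = _
    rw [← zpow_add_one, sub_add_cancel, ih]
    congr 1
    ring

/-- `τ (U^n V^m) = 0` for `(n, m) ≠ (0, 0)`, and `τ 1 = 1`. -/
theorem trace_monomial (θ : ℝ) (n m : ℤ) :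
    trace θ ((genU θ ^ n * genV θ ^ m : unitary (rotationAlgebra θ)) : rotationAlgebra θ) =
      if (n, m) = (0, 0) then 1 else 0 := by
  have hV := zpow_apply (genV θ) (fun k => lp.single 2 ((0, k) : ℤ × ℤ) (1 : ℂ))
    (fun k => by
      change opV θ _ = _
      rw [opV_single]
      simp) m 0
  have hU := zpow_apply (genU θ) (fun k => lp.single 2 ((k, m) : ℤ × ℤ) (1 : ℂ))
    (fun k => by
      change opU _ = _
      rw [opU_single]
      simp) n 0
  simp only [zero_add] at hV hU
  rw [trace_eq_inner]
  change inner ℂ _ (((((genU θ ^ n : unitary (rotationAlgebra θ)) : rotationAlgebra θ) :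
      L2Z2 →L[ℂ] L2Z2)) (((((genV θ ^ m : unitary (rotationAlgebra θ)) : rotationAlgebra θ) :
      L2Z2 →L[ℂ] L2Z2)) (lp.single 2 ((0, 0) : ℤ × ℤ) (1 : ℂ)))) = _
  rw [hV, hU, lp.inner_single_left]
  simp [lp.single_apply, Pi.single_apply, Prod.ext_iff, eq_comm]

/-- The right translations `e_{n,m} ↦ exp(2 π i θ b m) e_{n+b,m+c}` commute with `A_θ`. -/
theorem commute_right (θ : ℝ) (v : ℤ × ℤ) (x : rotationAlgebra θ) (f : L2Z2) :
    (x : L2Z2 →L[ℂ] L2Z2) (weightedShift (Equiv.subRight v)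
      (fun p => Circle.exp (2 * Real.pi * θ * (v.1 * (p.2 - v.2)))) f) =
    weightedShift (Equiv.subRight v)
      (fun p => Circle.exp (2 * Real.pi * θ * (v.1 * (p.2 - v.2)))) ((x : L2Z2 →L[ℂ] L2Z2) f) := by
  set R : unitary (L2Z2 →L[ℂ] L2Z2) := Unitary.linearIsometryEquiv.symm
    (weightedShift (Equiv.subRight v)
      (fun p => Circle.exp (2 * Real.pi * θ * (v.1 * (p.2 - v.2))))) with hR
  have hRa : ∀ (f : L2Z2) (q : ℤ × ℤ), (R : L2Z2 →L[ℂ] L2Z2) f q =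
      (Circle.exp (2 * Real.pi * θ * (v.1 * (q.2 - v.2))) : ℂ) * f (q - v) := fun _ _ => rfl
  have hU : opU * (R : L2Z2 →L[ℂ] L2Z2) = R * opU := by
    refine ContinuousLinearMap.ext fun f => ?_
    ext q
    rw [mul_apply_eq_comp, mul_apply_eq_comp, opU_apply, hRa, hRa,
      opU_apply, sub_right_comm]
    simp
  have hV : opV θ * (R : L2Z2 →L[ℂ] L2Z2) = R * opV θ := by
    refine ContinuousLinearMap.ext fun f => ?_
    ext q
    rw [mul_apply_eq_comp, mul_apply_eq_comp, opV_apply, hRa, hRa,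
      opV_apply, sub_right_comm]
    simp only [← mul_assoc, Circle.coe_exp, ← Complex.exp_add]
    congr 2
    push_cast [Prod.fst_sub, Prod.snd_sub]
    ring
  have hle : rotationAlgebra θ ≤ StarSubalgebra.centralizer ℂ {(R : L2Z2 →L[ℂ] L2Z2)} := by
    refine StarSubalgebra.topologicalClosure_minimal ?_ ?_
    · refine StarAlgebra.adjoin_le ?_
      have key : ∀ T : L2Z2 →L[ℂ] L2Z2, T * (R : L2Z2 →L[ℂ] L2Z2) = R * T →
          T ∈ StarSubalgebra.centralizer ℂ {(R : L2Z2 →L[ℂ] L2Z2)} := by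
        intro T hT
        rw [StarSubalgebra.mem_centralizer_iff]
        rintro g rfl
        refine ⟨hT.symm, ?_⟩
        have h1 : star (R : L2Z2 →L[ℂ] L2Z2) * R = 1 := Unitary.coe_star_mul_self R
        have h2 : (R : L2Z2 →L[ℂ] L2Z2) * star (R : L2Z2 →L[ℂ] L2Z2) = 1 :=
          Unitary.coe_mul_star_self R
        calc star (R : L2Z2 →L[ℂ] L2Z2) * T
            = star (R : L2Z2 →L[ℂ] L2Z2) * (T * R) * star (R : L2Z2 →L[ℂ] L2Z2) := by
              rw [mul_assoc, mul_assoc, h2, mul_one]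
          _ = T * star (R : L2Z2 →L[ℂ] L2Z2) := by
              rw [hT, ← mul_assoc, h1, one_mul]
      rintro T (rfl | rfl)
      · exact key _ hU
      · exact key _ hV
    · rw [StarSubalgebra.coe_centralizer]
      exact Set.isClosed_centralizer _
  have hx := ((StarSubalgebra.mem_centralizer_iff ℂ).1 (hle x.2) _ rfl).1
  exact (DFunLike.congr_fun hx f).symm

/-- The canonical trace is faithful, so densities with respect to it are unique. -/
theorem trace_faithful (θ : ℝ) (x : rotationAlgebra θ) (hx : trace θ (star x * x) = 0) :
    x = 0 := by
  have h0 : (x : L2Z2 →L[ℂ] L2Z2) (lp.single 2 (0 : ℤ × ℤ) (1 : ℂ)) = 0 := by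
    rw [trace_eq_inner] at hx
    change inner ℂ _ ((ContinuousLinearMap.adjoint (x : L2Z2 →L[ℂ] L2Z2))
      ((x : L2Z2 →L[ℂ] L2Z2) _)) = 0 at hx
    rwa [ContinuousLinearMap.adjoint_inner_right, inner_self_eq_zero] at hx
  have h1 : ∀ v : ℤ × ℤ, (x : L2Z2 →L[ℂ] L2Z2) (lp.single 2 v (1 : ℂ)) = 0 := by
    intro v
    have hv : weightedShift (Equiv.subRight v)
        (fun p => Circle.exp (2 * Real.pi * θ * (v.1 * (p.2 - v.2))))
        (lp.single 2 (0 : ℤ × ℤ) (1 : ℂ)) = (lp.single 2 v (1 : ℂ) : L2Z2) := by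
      ext q
      rw [weightedShift_apply]
      simp only [Equiv.subRight_apply, lp.single_apply, Pi.single_apply, sub_eq_zero]
      split_ifs with h
      · subst h
        simp
      · simp
    rw [← hv, commute_right, h0, map_zero]
  apply Subtype.ext
  refine ContinuousLinearMap.ext fun f => ?_
  have hs := (lp.hasSum_single (p := 2) (by norm_num) f).mapL (x : L2Z2 →L[ℂ] L2Z2)
  have hz : ∀ v, (x : L2Z2 →L[ℂ] L2Z2) (lp.single 2 v (f v)) = 0 := by
    intro v
    have : (lp.single 2 v (f v) : L2Z2) = (f v) • lp.single 2 v (1 : ℂ) := by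
      rw [← lp.single_smul, smul_eq_mul, mul_one]
    rw [this, map_smul, h1, smul_zero]
  simp only [hz] at hs
  exact hs.unique hasSum_zero

end NCTorus

end

noncomputable section

namespace NCTorus

open Filter Topology

/-! Apart from the construction of the trace, only a faithful tracial state `τ` on a unital
C*-algebra is used. With `Z = τ(e^{-βa})`, the Gibbs density `η = e^{-βa}/Z` has logarithm `-βa -
log Z`. For `φ = τ(· ξ)` with `τ ξ = 1` this gives `S(φ‖φβ) = S(φ‖τ) + β φ(a) + log Z`, which is the
entropy identity (`relEntropy_gibbs`). Both minima therefore reduce to `S(φ‖φβ) ≥ 0`, with value `0`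
at `φβ`.

Nonnegativity is Klein's inequality. Elements of a C*-algebra need not have spectral projections, so
the scalar inequality `t log t - (v + 1) t + e^v ≥ 0` is applied to `ξ` for each fixed `v`. A
Bernstein partition of unity in `b` then replaces `v` by a self-adjoint `b`
(`mul_log_tangent_map_nonneg`), using that `τ` is nonnegative on products of two positive elements.
The choice `b = log η` finishes the argument.

The KMS function is entire: shifting `z` by `iβ` produces factors `e^{∓βa}`, which the density and
cyclicity of `τ` absorb.

The trace property on `A_θ` comes from right translations commuting with the algebra: all vector
states at basis vectors agree, so `τ` is invariant under conjugation by `U` and `V`. -/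

/-- A faithful tracial state. -/
structure IsFaithfulTrace {A : Type*} [CStarAlgebra A] (τ : A →L[ℂ] ℂ) : Prop where
  isState : IsState τ
  faithful : ∀ x : A, τ (star x * x) = 0 → x = 0
  comm : ∀ x y : A, τ (x * y) = τ (y * x)

section CStar

variable {A : Type*} [CStarAlgebra A]

/-! ### Positive elements and the trace -/

theorem IsPos.isSelfAdjoint {x : A} (hx : IsPos x) : IsSelfAdjoint x := by
  obtain ⟨k, rfl⟩ := hx
  exact IsSelfAdjoint.star_mul_self k

theorem IsPos.spectrum_nonneg {x : A} (hx : IsPos x) : ∀ t ∈ spectrum ℝ x, 0 ≤ t := by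
  obtain ⟨k, rfl⟩ := hx
  exact spectrum_star_mul_self_nonneg

theorem isPos_one : IsPos (1 : A) := ⟨1, by simp⟩

theorem IsPos.smul {x : A} (hx : IsPos x) {r : ℝ} (hr : 0 ≤ r) : IsPos (r • x) := by
  obtain ⟨k, rfl⟩ := hx
  refine ⟨Real.sqrt r • k, ?_⟩
  rw [star_smul, smul_mul_smul_comm, star_trivial (Real.sqrt r), Real.mul_self_sqrt hr]

theorem isPos_map {C : Type*} [TopologicalSpace C] (Φ : C(C, ℝ) →⋆ₐ[ℝ] A)
    {g : C(C, ℝ)} (hg : ∀ u, 0 ≤ g u) : IsPos (Φ g) := by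
  refine ⟨Φ ⟨fun u => Real.sqrt (g u), by fun_prop⟩, ?_⟩
  rw [← map_star, ← map_mul]
  congr 1
  ext u
  simp [Real.mul_self_sqrt (hg u)]

theorem isPos_cfc {x : A} (hx : IsSelfAdjoint x) {f : ℝ → ℝ} (hf : Continuous f)
    (h : ∀ t ∈ spectrum ℝ x, 0 ≤ f t) : IsPos (cfc f x) := by
  rw [cfc_apply f x hx hf.continuousOn]
  exact isPos_map _ fun u => h u u.2

namespace IsFaithfulTrace

variable {τ : A →L[ℂ] ℂ}

/-- The product `k*k l*l` need not be positive, but cyclicity gives it the same trace as `(k l*)* (k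
l*)`. -/
theorem mul_nonneg (hτ : IsFaithfulTrace τ) {c d : A} (hc : IsPos c) (hd : IsPos d) :
    0 ≤ (τ (c * d)).re ∧ (τ (c * d)).im = 0 := by
  obtain ⟨k, rfl⟩ := hc
  obtain ⟨l, rfl⟩ := hd
  have h : τ (star k * k * (star l * l)) = τ (star (k * star l) * (k * star l)) := by
    rw [← mul_assoc, hτ.comm, star_mul, star_star]
    simp only [mul_assoc]
  rw [h]
  exact hτ.isState.2 _

theorem nonneg (hτ : IsFaithfulTrace τ) {c : A} (hc : IsPos c) : 0 ≤ (τ c).re ∧ (τ c).im = 0 := by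
  simpa using hτ.mul_nonneg hc isPos_one

end IsFaithfulTrace

/-! ### Klein's inequality -/

/-- For `t > 0` write `e^v = t e^{v - log t}` and use `1 + x ≤ e^x`. Geometrically, the graph of `t
log t` lies above its tangent at `t = e^v`. -/
theorem mul_log_tangent_nonneg {t : ℝ} (ht : 0 ≤ t) (v : ℝ) :
    0 ≤ t * Real.log t - (v + 1) * t + Real.exp v := by
  rcases ht.eq_or_lt with rfl | ht
  · simpa using (Real.exp_pos v).le
  · have h1 : Real.exp v = t * Real.exp (v - Real.log t) := by
      rw [Real.exp_sub, Real.exp_log ht]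
      field_simp
    have h2 := mul_le_mul_of_nonneg_left (Real.add_one_le_exp (v - Real.log t)) ht.le
    rw [h1]
    linarith

theorem isPos_mul_log_tangent {ξ : A} (hξ : IsPos ξ) (v : ℝ) :
    IsPos (cfc (fun t : ℝ => t * Real.log t) ξ - (v + 1) • ξ + Real.exp v • (1 : A)) := by
  have hs := hξ.isSelfAdjoint
  have hc : Continuous fun t : ℝ => t * Real.log t := Real.continuous_mul_log
  have h : cfc (fun t : ℝ => t * Real.log t - (v + 1) * t + Real.exp v) ξ =
      cfc (fun t : ℝ => t * Real.log t) ξ - (v + 1) • ξ + Real.exp v • (1 : A) := by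
    rw [cfc_add ξ _ _ (by fun_prop) (by fun_prop), cfc_sub _ _ ξ hc.continuousOn (by fun_prop),
      cfc_const_mul_id (v + 1) ξ hs, cfc_const (Real.exp v) ξ hs, Algebra.algebraMap_eq_smul_one]
  rw [← h]
  exact isPos_cfc hs (by fun_prop) fun t ht =>
    mul_log_tangent_nonneg (hξ.spectrum_nonneg t ht) v

namespace IsFaithfulTrace

variable {τ : A →L[ℂ] ℂ}

/-- The constant `v` becomes the function `G`. Bernstein approximation writes each `Φ g` as a limit
of `∑ g(z_k) Φ(B_k)` with `Φ(B_k)` positive, so the whole expression is a limit of sums of traces of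
products of two positive elements. The unit is kept as `Φ 1` so that all three terms expand alike.
-/
theorem mul_log_tangent_map_nonneg (hτ : IsFaithfulTrace τ) {ξ : A} (hξ : IsPos ξ) (Φ : C(unitInterval, ℝ) →⋆ₐ[ℝ] A)
    (hΦ : Continuous Φ) (G E : C(unitInterval, ℝ)) (hE : ∀ u, E u = Real.exp (G u)) :
    0 ≤ (τ (cfc (fun t : ℝ => t * Real.log t) ξ * Φ 1 - ξ * Φ (G + 1) + Φ E)).re := by
  set c := cfc (fun t : ℝ => t * Real.log t) ξ
  have hlim : Tendsto (fun n => (τ (c * Φ (bernsteinApproximation n 1) -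
      ξ * Φ (bernsteinApproximation n (G + 1)) + Φ (bernsteinApproximation n E))).re) atTop
      (𝓝 (τ (c * Φ 1 - ξ * Φ (G + 1) + Φ E)).re) := by
    have h : ∀ g : C(unitInterval, ℝ),
        Tendsto (fun n => Φ (bernsteinApproximation n g)) atTop (𝓝 (Φ g)) := fun g =>
      (hΦ.tendsto g).comp (bernsteinApproximation_uniform g)
    exact (Complex.continuous_re.tendsto _).comp ((τ.continuous.tendsto _).comp
      ((((h 1).const_mul c).sub ((h (G + 1)).const_mul ξ)).add (h E)))
  refine ge_of_tendsto' hlim fun n => ?_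
  have happ : ∀ g : C(unitInterval, ℝ), Φ (bernsteinApproximation n g) =
      ∑ k : Fin (n + 1), g (bernstein.z k) • Φ (bernstein n k) := by
    intro g
    rw [← Finset.sum_congr rfl fun k _ => map_smul Φ (g (bernstein.z k)) (bernstein n k),
      ← map_sum]
    congr 1
    ext u
    simp [bernsteinApproximation.apply, mul_comm]
  rw [happ, happ, happ, Finset.mul_sum, Finset.mul_sum, ← Finset.sum_sub_distrib,
    ← Finset.sum_add_distrib, map_sum, Complex.re_sum]
  refine Finset.sum_nonneg fun k _ => ?_
  -- The `k`-th summand is the tangent inequality at `v = G(z_k)`, paired with the positive weight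
  -- `Φ(B_k)`.
  have h := (hτ.mul_nonneg (isPos_mul_log_tangent hξ (G (bernstein.z k)))
    (isPos_map Φ (g := bernstein n k) fun u => bernstein_nonneg)).1
  refine h.trans_eq (congrArg (fun z => (τ z).re) ?_)
  rw [add_mul, sub_mul, smul_mul_assoc, smul_mul_assoc, one_mul, hE]
  simp [c]

/-- Klein's inequality, in the form of the Gibbs variational principle. -/
theorem klein_inequality (hτ : IsFaithfulTrace τ) {ξ b : A} (hξ : IsPos ξ) (hb : IsSelfAdjoint b) :
    (τ (ξ * b)).re + (τ ξ).re - (τ (NormedSpace.exp b)).re ≤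
      (τ (cfc (fun t : ℝ => t * Real.log t) ξ)).re := by
  -- The spectrum of `b` lies in `[-r, r]`, which is rescaled affinely to the unit interval; the `+
  -- 1` keeps `r` positive for the division.
  set r : ℝ := ‖b‖ * ‖(1 : A)‖ + 1
  have hr : 0 < r := by positivity
  have hsp : ∀ t ∈ spectrum ℝ b, (t + r) / (2 * r) ∈ unitInterval := by
    intro t ht
    have h := abs_le.1 (spectrum.norm_le_norm_mul_of_mem ht)
    rw [unitInterval, Set.mem_Icc, div_le_one (by positivity)]
    constructor
    · apply div_nonneg _ (by positivity)
      linarith [h.1]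
    · linarith [h.2]
  let p : C(spectrum ℝ b, unitInterval) :=
    ⟨fun t => ⟨(t + r) / (2 * r), hsp t t.2⟩, by fun_prop⟩
  let Φ : C(unitInterval, ℝ) →⋆ₐ[ℝ] A :=
    (cfcHom (R := ℝ) hb).comp (ContinuousMap.compStarAlgHom' ℝ ℝ p)
  have hΦ : Continuous Φ := (cfcHom_continuous hb).comp (ContinuousMap.continuous_precomp p)
  let G : C(unitInterval, ℝ) := ⟨fun u => 2 * r * u - r, by fun_prop⟩
  let E : C(unitInterval, ℝ) := ⟨fun u => Real.exp (2 * r * u - r), by fun_prop⟩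
  have hp : ∀ t : spectrum ℝ b, 2 * r * (p t : ℝ) - r = t := by
    intro t
    change 2 * r * ((t + r) / (2 * r)) - r = t
    field_simp
    ring
  have hG : Φ G = b := by
    conv_rhs => rw [← cfcHom_id hb (R := ℝ)]
    change cfcHom hb _ = _
    congr 1
    ext t
    exact hp t
  have hE : Φ E = NormedSpace.exp b := by
    rw [← CFC.real_exp_eq_normedSpace_exp hb,
      cfc_apply Real.exp b hb Real.continuous_exp.continuousOn]
    change cfcHom hb _ = _
    congr 1
    ext t
    exact congrArg Real.exp (hp t)
  have h := hτ.mul_log_tangent_map_nonneg hξ Φ hΦ G E fun u => rfl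
  rw [map_add Φ G 1, map_one, mul_one, hG, hE, mul_add, mul_one, map_add, map_sub, map_add,
    Complex.add_re, Complex.sub_re, Complex.add_re] at h
  linarith

end IsFaithfulTrace

/-! ### Boltzmann factor, time evolution and KMS function -/

theorem boltzmann_eq_star_mul_self {a : A} (ha : IsSelfAdjoint a) (β : ℝ) :
    boltzmann β a = star (NormedSpace.exp ((-β / 2) • a)) * NormedSpace.exp ((-β / 2) • a) := by
  let +nondep : NormedAlgebra ℚ A := .restrictScalars ℚ ℂ A
  have h : IsSelfAdjoint ((-β / 2) • a) := (IsSelfAdjoint.all (-β / 2)).smul ha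
  rw [NormedSpace.star_exp, h.star_eq, ← NormedSpace.exp_add_of_commute (Commute.refl _),
    ← add_smul, add_halves, boltzmann]

theorem isPos_boltzmann {a : A} (ha : IsSelfAdjoint a) (β : ℝ) : IsPos (boltzmann β a) :=
  ⟨_, boltzmann_eq_star_mul_self ha β⟩

theorem isTimeEvolution_evolution (a : selfAdjoint A) : IsTimeEvolution (evolution a) where
  map_zero b := by simp [evolution]
  map_add s t b := by
    have h : Commute ((s • a : selfAdjoint A) : A) ((t • a : selfAdjoint A) : A) := by
      simp only [selfAdjoint.val_smul]
      exact ((Commute.refl (a : A)).smul_left s).smul_right t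
    rw [evolution, add_smul, h.expUnitary_add, map_mul]
    rfl
  continuous b := by
    simp only [evolution, Unitary.conjStarAlgAut_apply]
    have h : Continuous fun t : ℝ => ((selfAdjoint.expUnitary (t • a) : unitary A) : A) :=
      continuous_subtype_val.comp
        (selfAdjoint.continuous_expUnitary.comp (continuous_id.smul continuous_const))
    exact (h.mul continuous_const).mul h.star

/-- `σ_t b = exp (i t a) b exp (- i t a)`. -/
theorem evolution_apply (a : selfAdjoint A) (t : ℝ) (b : A) :
    evolution a t b = NormedSpace.exp ((t * Complex.I) • (a : A)) * b *
      NormedSpace.exp (-(t * Complex.I) • (a : A)) := by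
  let +nondep : NormedAlgebra ℚ A := .restrictScalars ℚ ℂ A
  have h : Complex.I • ((t • a : selfAdjoint A) : A) = (t * Complex.I) • (a : A) := by
    rw [selfAdjoint.val_smul, ← Complex.coe_smul, smul_smul, mul_comm]
  have ha : star (a : A) = a := a.2
  rw [evolution, Unitary.conjStarAlgAut_apply, ← Unitary.coe_star, Unitary.coe_star,
    selfAdjoint.expUnitary_coe, h, NormedSpace.star_exp, star_smul, ha]
  simp

/-- For a functional `φ = τ (· exp (- β a))`, the function `F` of the KMS condition is entire. -/
def kmsFunction (τ : A →L[ℂ] ℂ) (β : ℝ) (a x y : A) (z : ℂ) : ℂ :=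
  τ (x * (NormedSpace.exp (z • Complex.I • a) * y * NormedSpace.exp (z • (-Complex.I) • a)) *
    boltzmann β a)

theorem differentiable_kmsFunction (τ : A →L[ℂ] ℂ) (β : ℝ) (a x y : A) :
    Differentiable ℂ (kmsFunction τ β a x y) := by
  have h : ∀ c : A, Differentiable ℂ fun z : ℂ => NormedSpace.exp (z • c) := fun c z =>
    (hasDerivAt_exp_smul_const c z).differentiableAt
  unfold kmsFunction
  have h1 := h (Complex.I • a)
  have h2 := h ((-Complex.I) • a)
  exact τ.differentiable.comp ((((h1.mul_const y).mul h2).const_mul x).mul_const _)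

theorem norm_exp_le [Nontrivial A] (x : A) : ‖NormedSpace.exp x‖ ≤ Real.exp ‖x‖ := by
  have h1 := NormedSpace.exp_series_hasSum_exp' (𝕂 := ℝ) x
  have h2 := NormedSpace.exp_series_hasSum_exp' (𝕂 := ℝ) ‖x‖
  rw [← Real.exp_eq_exp_ℝ] at h2
  refine h1.norm_le_of_bounded h2 fun n => ?_
  rw [norm_smul, smul_eq_mul, norm_inv, Real.norm_natCast]
  exact mul_le_mul_of_nonneg_left (norm_pow_le x n) (by positivity)

/-- The unitary group `exp (i s a)` is norm bounded, so `exp (± i z a)` is bounded on strips. -/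
theorem norm_exp_smul_le [Nontrivial A] {a : A} (ha : IsSelfAdjoint a) (z : ℂ) :
    ‖NormedSpace.exp (z • Complex.I • a)‖ ≤ Real.exp (|z.im| * ‖a‖) := by
  let +nondep : NormedAlgebra ℚ A := .restrictScalars ℚ ℂ A
  -- Splitting off the real part of `z` isolates a unitary factor; only `-(Im z) a` contributes to
  -- the norm.
  have h : z • Complex.I • a =
      Complex.I • ((z.re • (⟨a, ha⟩ : selfAdjoint A) : selfAdjoint A) : A) + (-z.im) • a := by
    rw [selfAdjoint.val_smul, ← Complex.coe_smul, ← Complex.coe_smul, smul_smul, smul_smul,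
      ← add_smul]
    congr 1
    apply Complex.ext <;> simp
  have hcomm : Commute (Complex.I • ((z.re • (⟨a, ha⟩ : selfAdjoint A) : selfAdjoint A) : A))
      ((-z.im) • a) := by
    rw [selfAdjoint.val_smul]
    exact (((Commute.refl a).smul_left _).smul_left _).smul_right _
  rw [h, NormedSpace.exp_add_of_commute hcomm, ← selfAdjoint.expUnitary_coe,
    CStarRing.norm_coe_unitary_mul]
  refine (norm_exp_le _).trans ?_
  rw [norm_smul, Real.norm_eq_abs, abs_neg]

theorem kmsFunction_ofReal (τ : A →L[ℂ] ℂ) (β : ℝ) (a : selfAdjoint A) (x y : A) (t : ℝ) :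
    kmsFunction τ β a x y t = τ (x * evolution a t y * boltzmann β (a : A)) := by
  rw [kmsFunction, evolution_apply, smul_smul, smul_smul, mul_neg]

/-- At `t + iβ` the exponentials become `e^{-βa} e^{ita}` on the left of `y` and `e^{-ita} e^{βa}`
on its right. The factor `e^{βa}` cancels the density, and cyclicity carries `x e^{-βa}` to the
right end. -/
theorem kmsFunction_add_mul_I {τ : A →L[ℂ] ℂ} (hτ : ∀ x y : A, τ (x * y) = τ (y * x)) (β : ℝ)
    (a : selfAdjoint A) (x y : A) (t : ℝ) :
    kmsFunction τ β a x y (t + β * Complex.I) = τ (evolution a t y * x * boltzmann β (a : A)) := by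
  let +nondep : NormedAlgebra ℚ A := .restrictScalars ℚ ℂ A
  have hadd : ∀ u v : ℂ, NormedSpace.exp ((u + v) • (a : A)) =
      NormedSpace.exp (u • (a : A)) * NormedSpace.exp (v • (a : A)) := fun u v => by
    rw [add_smul, NormedSpace.exp_add_of_commute (((Commute.refl (a : A)).smul_left u).smul_right v)]
  have hβ : boltzmann β (a : A) = NormedSpace.exp ((-(β : ℂ)) • (a : A)) := by
    rw [boltzmann, ← Complex.coe_smul, Complex.ofReal_neg]
  have h1 : (t + β * Complex.I) • Complex.I • (a : A) = (-(β : ℂ) + t * Complex.I) • (a : A) := by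
    rw [smul_smul]
    congr 1
    linear_combination (β : ℂ) * Complex.I_mul_I
  have h2 : (t + β * Complex.I) • (-Complex.I) • (a : A) =
      (-(t * Complex.I) + β) • (a : A) := by
    rw [smul_smul]
    congr 1
    linear_combination -(β : ℂ) * Complex.I_mul_I
  have h3 : NormedSpace.exp ((β : ℂ) • (a : A)) * NormedSpace.exp ((-(β : ℂ)) • (a : A)) = 1 := by
    rw [← hadd, add_neg_cancel, zero_smul, NormedSpace.exp_zero]
  rw [kmsFunction, h1, h2, hadd, hadd, evolution_apply, hβ]
  simp only [mul_assoc, h3, mul_one]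
  rw [← mul_assoc, hτ]
  simp only [mul_assoc]

/-! ### The Gibbs state -/

namespace IsFaithfulTrace

variable {τ : A →L[ℂ] ℂ}

theorem nontrivial (hτ : IsFaithfulTrace τ) : Nontrivial A := by
  refine ⟨1, 0, fun h => ?_⟩
  have := hτ.isState.1
  simp [h] at this

theorem apply_boltzmann_eq_re (hτ : IsFaithfulTrace τ) {a : A} (ha : IsSelfAdjoint a) (β : ℝ) :
    τ (boltzmann β a) = ((τ (boltzmann β a)).re : ℂ) :=
  Complex.ext rfl (hτ.nonneg (isPos_boltzmann ha β)).2

/-- If the trace vanished, faithfulness would force `e^{-βa/2} = 0`, but this element is invertible.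
-/
theorem apply_boltzmann_re_pos (hτ : IsFaithfulTrace τ) {a : A} (ha : IsSelfAdjoint a) (β : ℝ) :
    0 < (τ (boltzmann β a)).re := by
  let +nondep : NormedAlgebra ℚ A := .restrictScalars ℚ ℂ A
  have := hτ.nontrivial
  refine lt_of_le_of_ne (hτ.nonneg (isPos_boltzmann ha β)).1 fun h0 => ?_
  have h1 := hτ.apply_boltzmann_eq_re ha β
  rw [← h0, Complex.ofReal_zero, boltzmann_eq_star_mul_self ha] at h1
  exact (NormedSpace.isUnit_exp ((-β / 2) • a)).ne_zero (hτ.faithful _ h1)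

theorem gibbs_eq (hτ : IsFaithfulTrace τ) {a : A} (ha : IsSelfAdjoint a) (β : ℝ) :
    gibbs τ β a = densityFunctional τ ((τ (boltzmann β a)).re⁻¹ • boltzmann β a) := by
  ext b
  rw [densityFunctional_apply, mul_smul_comm, ← Complex.coe_smul, map_smul, Complex.ofReal_inv,
    ← hτ.apply_boltzmann_eq_re ha β]
  rfl

theorem isPos_gibbsDensity (hτ : IsFaithfulTrace τ) {a : A} (ha : IsSelfAdjoint a) (β : ℝ) :
    IsPos ((τ (boltzmann β a)).re⁻¹ • boltzmann β a) :=
  (isPos_boltzmann ha β).smul (inv_nonneg.2 (hτ.apply_boltzmann_re_pos ha β).le)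

theorem gibbs_mem_statesWithDensity (hτ : IsFaithfulTrace τ) {a : A} (ha : IsSelfAdjoint a) (β : ℝ) :
    gibbs τ β a ∈ statesWithDensity τ := by
  refine ⟨⟨?_, fun x => ?_⟩, _, hτ.isPos_gibbsDensity ha β, hτ.gibbs_eq ha β⟩
  · have h : τ (boltzmann β a) ≠ 0 := by
      rw [hτ.apply_boltzmann_eq_re ha β]
      exact_mod_cast (hτ.apply_boltzmann_re_pos ha β).ne'
    change (τ (boltzmann β a))⁻¹ * τ (1 * boltzmann β a) = 1
    rw [one_mul, inv_mul_cancel₀ h]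
  · rw [hτ.gibbs_eq ha, densityFunctional_apply]
    exact hτ.mul_nonneg ⟨x, rfl⟩ (hτ.isPos_gibbsDensity ha β)

theorem isKMSState_gibbs (hτ : IsFaithfulTrace τ) (a : selfAdjoint A) (β : ℝ) :
    IsKMSState (evolution a) β (gibbs τ β (a : A)) := by
  have := hτ.nontrivial
  refine ⟨(hτ.gibbs_mem_statesWithDensity a.2 β).1, fun x y =>
    ⟨fun z => (τ (boltzmann β (a : A)))⁻¹ * kmsFunction τ β a x y z, ?_, ?_, ?_, fun t => ⟨?_, ?_⟩⟩⟩
  · exact (continuous_const.mul (differentiable_kmsFunction τ β (a : A) x y).continuous).continuousOn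
  · exact ((differentiable_kmsFunction τ β (a : A) x y).const_mul _).differentiableOn
  · set M := Real.exp (β * ‖(a : A)‖)
    refine ⟨‖(τ (boltzmann β (a : A)))⁻¹‖ * (‖τ‖ * (‖x‖ * (M * ‖y‖ * M) * ‖boltzmann β (a : A)‖)),
      fun z h0 h1 => ?_⟩
    have hM : ∀ w : ℂ, |w.im| ≤ β → ‖NormedSpace.exp (w • Complex.I • (a : A))‖ ≤ M := fun w hw =>
      (norm_exp_smul_le a.2 w).trans
        (Real.exp_le_exp.2 (mul_le_mul_of_nonneg_right hw (norm_nonneg _)))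
    have hz : |z.im| ≤ β := by rwa [abs_of_nonneg h0]
    have hz1 := hM z hz
    have hz2 : ‖NormedSpace.exp (z • (-Complex.I) • (a : A))‖ ≤ M := by
      -- The right-hand exponential is the left-hand one evaluated at `-z`.
      have h := hM (-z) (by simpa using hz)
      rwa [neg_smul, ← smul_neg, ← neg_smul] at h
    rw [norm_mul, kmsFunction]
    refine mul_le_mul_of_nonneg_left ?_ (norm_nonneg _)
    refine (τ.le_opNorm _).trans (mul_le_mul_of_nonneg_left ?_ (norm_nonneg _))
    refine (norm_mul_le _ _).trans (mul_le_mul_of_nonneg_right ?_ (norm_nonneg _))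
    refine (norm_mul_le _ _).trans (mul_le_mul_of_nonneg_left ?_ (norm_nonneg _))
    refine (norm_mul_le _ _).trans (mul_le_mul ?_ hz2 (norm_nonneg _) (by positivity))
    exact (norm_mul_le _ _).trans (mul_le_mul_of_nonneg_right hz1 (norm_nonneg _))
  · dsimp only
    rw [kmsFunction_ofReal]
    rfl
  · dsimp only
    rw [kmsFunction_add_mul_I hτ.comm]
    rfl

/-! ### Relative entropy and the variational principle -/

theorem density_self (hτ : IsFaithfulTrace τ) : density τ τ = 1 := by
  have h : densityFunctional τ 1 = τ := by
    ext b
    simp [densityFunctional_apply]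
  have h1 := density_densityFunctional hτ.faithful (isPos_one (A := A))
  rwa [h] at h1

theorem density_gibbs (hτ : IsFaithfulTrace τ) {a : A} (ha : IsSelfAdjoint a) (β : ℝ) :
    density τ (gibbs τ β a) = (τ (boltzmann β a)).re⁻¹ • boltzmann β a := by
  rw [hτ.gibbs_eq ha, density_densityFunctional hτ.faithful (hτ.isPos_gibbsDensity ha β)]

theorem relEntropy_self (hτ : IsFaithfulTrace τ) {ξ : A} (hξ : IsPos ξ) :
    relEntropy τ (densityFunctional τ ξ) τ = (τ (cfc (fun t : ℝ => t * Real.log t) ξ)).re := by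
  rw [relEntropy, hτ.density_self, density_densityFunctional hτ.faithful hξ, CFC.log_one, mul_zero,
    sub_zero]

theorem log_gibbsDensity (hτ : IsFaithfulTrace τ) {a : A} (ha : IsSelfAdjoint a) (β : ℝ) :
    CFC.log ((τ (boltzmann β a)).re⁻¹ • boltzmann β a) =
      (-β) • a - Real.log (τ (boltzmann β a)).re • (1 : A) := by
  let +nondep : NormedAlgebra ℚ A := .restrictScalars ℚ ℂ A
  have hb : IsSelfAdjoint ((-β) • a) := (IsSelfAdjoint.all (-β)).smul ha
  have hu : IsUnit (boltzmann β a) := NormedSpace.isUnit_exp _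
  rw [CFC.log_smul _ (fun t ht h0 => spectrum.zero_notMem ℝ hu (h0 ▸ ht))
    (inv_ne_zero (hτ.apply_boltzmann_re_pos ha β).ne') (isPos_boltzmann ha β).isSelfAdjoint,
    Real.log_inv, boltzmann, CFC.log_exp _ hb, Algebra.algebraMap_eq_smul_one, neg_smul]
  abel

theorem relEntropy_gibbs (hτ : IsFaithfulTrace τ) {a : A} (ha : IsSelfAdjoint a) (β : ℝ) {ξ : A} (hξ : IsPos ξ)
    (h1 : τ ξ = 1) :
    relEntropy τ (densityFunctional τ ξ) (gibbs τ β a) =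
      relEntropy τ (densityFunctional τ ξ) τ + β * (densityFunctional τ ξ a).re +
        Real.log (τ (boltzmann β a)).re := by
  rw [hτ.relEntropy_self hξ, relEntropy, density_densityFunctional hτ.faithful hξ,
    hτ.density_gibbs ha, hτ.log_gibbsDensity ha, mul_sub, mul_smul_comm, mul_smul_comm, mul_one,
    map_sub, map_sub, ← Complex.coe_smul, ← Complex.coe_smul, map_smul, map_smul, h1,
    densityFunctional_apply, hτ.comm a]
  simp
  ring

/-- Klein's inequality is applied with `b` the logarithm of the Gibbs density; the terms `τ ξ` and
`τ(e^b)` both equal `1` and cancel. -/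
theorem relEntropy_gibbs_nonneg (hτ : IsFaithfulTrace τ) {a : A} (ha : IsSelfAdjoint a) (β : ℝ) {ξ : A} (hξ : IsPos ξ)
    (h1 : τ ξ = 1) : 0 ≤ relEntropy τ (densityFunctional τ ξ) (gibbs τ β a) := by
  set L := Real.log (τ (boltzmann β a)).re with hL
  let +nondep : NormedAlgebra ℚ A := .restrictScalars ℚ ℂ A
  have hZ := hτ.apply_boltzmann_re_pos ha β
  have hb : IsSelfAdjoint ((-β) • a - L • (1 : A)) :=
    ((IsSelfAdjoint.all (-β)).smul ha).sub ((IsSelfAdjoint.all L).smul (IsSelfAdjoint.one A))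
  have hexp : NormedSpace.exp ((-β) • a - L • (1 : A)) =
      (τ (boltzmann β a)).re⁻¹ • boltzmann β a := by
    rw [sub_eq_add_neg, ← neg_smul, ← Algebra.algebraMap_eq_smul_one,
      NormedSpace.exp_add_of_commute (Algebra.commute_algebraMap_right _ _),
      ← NormedSpace.algebraMap_exp_comm, ← Real.exp_eq_exp_ℝ, Real.exp_neg, hL, Real.exp_log hZ,
      ← Algebra.commutes, ← Algebra.smul_def, boltzmann]
  have h := hτ.klein_inequality hξ hb
  have h2 : τ ((τ (boltzmann β a)).re⁻¹ • boltzmann β a) = 1 := by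
    have h3 := (hτ.gibbs_mem_statesWithDensity ha β).1.1
    rwa [hτ.gibbs_eq ha, densityFunctional_apply, one_mul] at h3
  rw [hexp, h2, h1] at h
  rw [relEntropy, density_densityFunctional hτ.faithful hξ, hτ.density_gibbs ha,
    hτ.log_gibbsDensity ha, map_sub, Complex.sub_re]
  linarith

theorem relEntropy_gibbs_gibbs (hτ : IsFaithfulTrace τ) {a : A} (ha : IsSelfAdjoint a) (β : ℝ) :
    relEntropy τ (gibbs τ β a) (gibbs τ β a) = 0 := by
  have hs := (hτ.isPos_gibbsDensity ha β).isSelfAdjoint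
  rw [relEntropy, hτ.density_gibbs ha]
  set η := (τ (boltzmann β a)).re⁻¹ • boltzmann β a
  have hu : IsUnit η := by
    let +nondep : NormedAlgebra ℚ A := .restrictScalars ℚ ℂ A
    have hZ := (hτ.apply_boltzmann_re_pos ha β).ne'
    exact (NormedSpace.isUnit_exp ((-β) • a)).smul (Units.mk0 _ (inv_ne_zero hZ))
  -- Invertibility keeps `0` out of the spectrum, so `t log t` may be split into a product within
  -- the functional calculus.
  have hc : ContinuousOn Real.log (spectrum ℝ η) := Real.continuousOn_log.mono fun t ht h0 =>
    spectrum.zero_notMem ℝ hu (h0 ▸ ht)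
  rw [cfc_mul (fun t : ℝ => t) Real.log η (by fun_prop) hc, cfc_id' ℝ η, CFC.log, sub_self, map_zero,
    Complex.zero_re]

/-- The relative entropy identity. -/
theorem apply_add_relEntropy (hτ : IsFaithfulTrace τ) {φ : A →L[ℂ] ℂ} (hφ : φ ∈ statesWithDensity τ) (h : A) {β : ℝ}
    (hβ : 0 < β) :
    φ (star h * h) + ((β⁻¹ * relEntropy τ φ τ : ℝ) : ℂ) =
      ((β⁻¹ * relEntropy τ φ (gibbs τ β (star h * h)) -
        β⁻¹ * Real.log (τ (boltzmann β (star h * h))).re : ℝ) : ℂ) := by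
  obtain ⟨hs, ξ, hξ, rfl⟩ := hφ
  have h1 : τ ξ = 1 := by simpa [densityFunctional_apply] using hs.1
  rw [hτ.relEntropy_gibbs (IsSelfAdjoint.star_mul_self h) β hξ h1]
  apply Complex.ext
  · rw [Complex.add_re, Complex.ofReal_re, Complex.ofReal_re]
    field_simp
    ring
  -- A state takes a real value at `h* h`.
  · rw [Complex.add_im, Complex.ofReal_im, Complex.ofReal_im, (hs.2 h).2, add_zero]

theorem isLeast_relEntropy_gibbs (hτ : IsFaithfulTrace τ) {a : A} (ha : IsSelfAdjoint a) {β : ℝ} (hβ : 0 < β) :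
    IsLeast {x : ℝ | ∃ φ ∈ statesWithDensity τ,
      x = β⁻¹ * relEntropy τ φ (gibbs τ β a) - β⁻¹ * Real.log (τ (boltzmann β a)).re}
      (-β⁻¹ * Real.log (τ (boltzmann β a)).re) := by
  refine ⟨⟨_, hτ.gibbs_mem_statesWithDensity ha β, ?_⟩, ?_⟩
  · rw [hτ.relEntropy_gibbs_gibbs ha]
    ring
  · rintro _ ⟨_, ⟨hs, ξ, hξ, rfl⟩, rfl⟩
    have h1 : τ ξ = 1 := by simpa [densityFunctional_apply] using hs.1
    have := _root_.mul_nonneg (inv_nonneg.2 hβ.le) (hτ.relEntropy_gibbs_nonneg ha β hξ h1)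
    linarith

theorem freeEnergyValues_eq (hτ : IsFaithfulTrace τ) (h : A) {β : ℝ} (hβ : 0 < β) :
    freeEnergyValues τ β (star h * h) = {x : ℝ | ∃ φ ∈ statesWithDensity τ,
      x = β⁻¹ * relEntropy τ φ (gibbs τ β (star h * h)) -
        β⁻¹ * Real.log (τ (boltzmann β (star h * h))).re} := by
  ext x
  refine exists_congr fun φ => and_congr_right fun hφ => ?_
  have := congrArg Complex.re (hτ.apply_add_relEntropy hφ h hβ)
  rw [Complex.add_re, Complex.ofReal_re, Complex.ofReal_re] at this
  rw [this]

end IsFaithfulTrace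

end CStar

/-! ### The canonical trace is a faithful tracial state -/

/-- The phase exponent `v.1 * (p.2 - v.2)` vanishes at `p = v`, so the translated basis vector
carries no scalar. -/
theorem weightedShift_single_zero (θ : ℝ) (v : ℤ × ℤ) :
    weightedShift (Equiv.subRight v)
      (fun p => Circle.exp (2 * Real.pi * θ * (v.1 * (p.2 - v.2))))
      (lp.single 2 (0 : ℤ × ℤ) (1 : ℂ)) = (lp.single 2 v (1 : ℂ) : L2Z2) := by
  ext q
  rw [weightedShift_apply]
  simp only [Equiv.subRight_apply, lp.single_apply, Pi.single_apply, sub_eq_zero]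
  split_ifs with h
  · subst h
    simp
  · simp

/-- All the vector states `⟨e_v, b e_v⟩` agree with the trace on `A_θ`. -/
theorem inner_single_eq_trace (θ : ℝ) (v : ℤ × ℤ) (b : rotationAlgebra θ) :
    inner ℂ (lp.single 2 v (1 : ℂ) : L2Z2) ((b : L2Z2 →L[ℂ] L2Z2) (lp.single 2 v (1 : ℂ))) =
      trace θ b := by
  rw [← weightedShift_single_zero θ v, commute_right, LinearIsometryEquiv.inner_map_map,
    trace_eq_inner]

theorem inner_star_apply (θ : ℝ) (b : rotationAlgebra θ) (f g : L2Z2) :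
    inner ℂ f (((star b : rotationAlgebra θ) : L2Z2 →L[ℂ] L2Z2) g) =
      inner ℂ ((b : L2Z2 →L[ℂ] L2Z2) f) g := by
  change inner ℂ f (ContinuousLinearMap.adjoint (b : L2Z2 →L[ℂ] L2Z2) g) = _
  rw [ContinuousLinearMap.adjoint_inner_right]

theorem coe_mul_apply {θ : ℝ} (b c : rotationAlgebra θ) (f : L2Z2) :
    ((b * c : rotationAlgebra θ) : L2Z2 →L[ℂ] L2Z2) f =
      (b : L2Z2 →L[ℂ] L2Z2) ((c : L2Z2 →L[ℂ] L2Z2) f) := rfl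

/-- The left side is the vector state of `b` at `u e_0 = e_v`, and all these vector states coincide.
-/
theorem trace_star_mul_mul (θ : ℝ) (u b : rotationAlgebra θ) (v : ℤ × ℤ)
    (hu : (u : L2Z2 →L[ℂ] L2Z2) (lp.single 2 (0 : ℤ × ℤ) (1 : ℂ)) = lp.single 2 v (1 : ℂ)) :
    trace θ (star u * b * u) = trace θ b := by
  rw [trace_eq_inner, mul_assoc, coe_mul_apply, inner_star_apply, coe_mul_apply, hu,
    inner_single_eq_trace]

theorem trace_star (θ : ℝ) (b : rotationAlgebra θ) :
    trace θ (star b) = starRingEnd ℂ (trace θ b) := by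
  rw [trace_eq_inner, trace_eq_inner, inner_conj_symm, inner_star_apply]

theorem isState_trace (θ : ℝ) : IsState (trace θ) := by
  refine ⟨?_, fun x => ?_⟩
  · simpa using trace_monomial θ 0 0
  · rw [trace_eq_inner, coe_mul_apply, inner_star_apply]
    exact ⟨inner_self_nonneg (𝕜 := ℂ), inner_self_im (𝕜 := ℂ) _⟩

/-- The elements `x` with `τ (x y) = τ (y x)` for all `y` form a `*`-subalgebra. -/
def tracialSubalgebra (θ : ℝ) : StarSubalgebra ℂ (rotationAlgebra θ) where
  carrier := {x | ∀ y, trace θ (x * y) = trace θ (y * x)}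
  mul_mem' {x z} hx hz y := by
    rw [mul_assoc, hx, mul_assoc, hz, mul_assoc]
  add_mem' {x z} hx hz y := by
    rw [add_mul, mul_add, map_add, map_add, hx, hz]
  algebraMap_mem' r y := by rw [Algebra.commutes]
  star_mem' {x} hx y := by
    have h := hx (star y)
    rw [← star_star (x * star y), ← star_star (star y * x), trace_star, trace_star (b := star _)] at h
    simpa using ((starRingEnd ℂ).injective h).symm

theorem mem_tracialSubalgebra (θ : ℝ) (u : unitary (rotationAlgebra θ)) (v : ℤ × ℤ)
    (hu : ((u : rotationAlgebra θ) : L2Z2 →L[ℂ] L2Z2) (lp.single 2 (0 : ℤ × ℤ) (1 : ℂ)) =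
      lp.single 2 v (1 : ℂ)) :
    (u : rotationAlgebra θ) ∈ tracialSubalgebra θ := by
  intro y
  -- Conjugating `u y` by `u` gives `u* (u y) u = y u`.
  rw [← trace_star_mul_mul θ u (u * y) v hu, ← mul_assoc, Unitary.coe_star_mul_self, one_mul]

theorem trace_mul_comm (θ : ℝ) (x y : rotationAlgebra θ) :
    trace θ (x * y) = trace θ (y * x) := by
  have hU : (genU θ : rotationAlgebra θ) ∈ tracialSubalgebra θ :=
    mem_tracialSubalgebra θ _ (0 + (1, 0)) (opU_single 0)
  -- The phase of `V` on `e_{0,0}` is `1`, its first index being `0`.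
  have hV : (genV θ : rotationAlgebra θ) ∈ tracialSubalgebra θ :=
    mem_tracialSubalgebra θ _ (0 + (0, 1)) ((opV_single θ 0).trans (by simp))
  have hle : StarAlgebra.adjoin ℂ {opU, opV θ} ≤
      (tracialSubalgebra θ).map (rotationAlgebra θ).subtype := by
    refine StarAlgebra.adjoin_le ?_
    rintro T (rfl | rfl)
    · exact ⟨_, hU, rfl⟩
    · exact ⟨_, hV, rfl⟩
  have hdense : ∀ z : rotationAlgebra θ, z ∈ closure (tracialSubalgebra θ : Set (rotationAlgebra θ)) := by
    intro z
    rw [closure_subtype]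
    exact closure_mono (by exact hle) z.2
  -- For fixed `y` the trace identity is a closed condition, so it passes from the dense tracial
  -- subalgebra to all of `A_θ`.
  have hclosed : IsClosed {z : rotationAlgebra θ | trace θ (z * y) = trace θ (y * z)} :=
    isClosed_eq (by fun_prop) (by fun_prop)
  exact closure_minimal (fun z (hz : z ∈ tracialSubalgebra θ) => hz y) hclosed (hdense x)

theorem isFaithfulTrace_trace (θ : ℝ) : IsFaithfulTrace (trace θ) :=
  ⟨isState_trace θ, trace_faithful θ, trace_mul_comm θ⟩

end NCTorus

end

theorem proposition2p6 (θ : ℝ) (hθ : Irrational θ) (β : ℝ) (hβ : 0 < β)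
    (h : NCTorus.rotationAlgebra θ) :
    let τ := NCTorus.trace θ
    let a := star h * h
    let Z : ℝ := (τ (NCTorus.boltzmann β a)).re
    let φβ := NCTorus.gibbs τ β a
    let σ := NCTorus.evolution ⟨a, IsSelfAdjoint.star_mul_self h⟩
    -- the partition function `Z = τ (exp (- β a))` is real and positive
    τ (NCTorus.boltzmann β a) = (Z : ℂ) ∧ 0 < Z ∧
    -- `σ` is a time evolution, and `φβ` is a `KMS_β` state for it, with a density
    NCTorus.IsTimeEvolution σ ∧
    NCTorus.IsKMSState σ β φβ ∧ φβ ∈ NCTorus.statesWithDensity τ ∧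
    -- the relative entropy identity
    (∀ φ ∈ NCTorus.statesWithDensity τ,
      φ a + ((β⁻¹ * NCTorus.relEntropy τ φ τ : ℝ) : ℂ) =
        ((β⁻¹ * NCTorus.relEntropy τ φ φβ - β⁻¹ * Real.log Z : ℝ) : ℂ)) ∧
    -- both minima exist and are equal to the Helmholtz free energy `- β⁻¹ log Z`
    IsLeast (NCTorus.freeEnergyValues τ β a) (NCTorus.deformedTrace τ β a) ∧
    IsLeast {x : ℝ | ∃ φ ∈ NCTorus.statesWithDensity τ,
      x = β⁻¹ * NCTorus.relEntropy τ φ φβ - β⁻¹ * Real.log Z} (NCTorus.deformedTrace τ β a) ∧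
    NCTorus.deformedTrace τ β a = -β⁻¹ * Real.log Z ∧
    -- the minimum is attained at `φβ`
    (φβ a).re + β⁻¹ * NCTorus.relEntropy τ φβ τ = NCTorus.deformedTrace τ β a := by
  have hτ := NCTorus.isFaithfulTrace_trace θ
  intro τ a Z φβ σ
  have ha : IsSelfAdjoint a := IsSelfAdjoint.star_mul_self h
  have hφβ : φβ ∈ NCTorus.statesWithDensity τ := hτ.gibbs_mem_statesWithDensity ha β
  have hmin := hτ.isLeast_relEntropy_gibbs ha hβ
  have hF : NCTorus.deformedTrace τ β a = -β⁻¹ * Real.log Z := by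
    rw [NCTorus.deformedTrace, hτ.freeEnergyValues_eq h hβ, hmin.csInf_eq]
  refine ⟨hτ.apply_boltzmann_eq_re ha β, hτ.apply_boltzmann_re_pos ha β,
    NCTorus.isTimeEvolution_evolution _, hτ.isKMSState_gibbs ⟨a, ha⟩ β, hφβ,
    fun φ hφ => hτ.apply_add_relEntropy hφ h hβ, ?_, ?_, hF, ?_⟩
  · rw [hF, hτ.freeEnergyValues_eq h hβ]
    exact hmin
  · rw [hF]
    exact hmin
  -- At `φβ` itself the relative entropy term of the identity vanishes.
  · have h1 := congrArg Complex.re (hτ.apply_add_relEntropy hφβ h hβ)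
    rw [Complex.add_re, Complex.ofReal_re, Complex.ofReal_re, hτ.relEntropy_gibbs_gibbs ha] at h1
    rw [hF, h1]
    ring
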